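/- Let $\alpha$ be an ordinal and $m$ an infinite ordinal with $m<\alpha$. An $m$-transformation of $\alpha$ is a map $\tau:\alpha\to\alpha$ with $\tau i=i$ except for at most $|m|$ many $i\in\alpha$; let ${}_mT_\alpha$ be the set of all of them. For $i,j\in\alpha$, $[i/j]$ is the map that sends $i$ to $j$ and fixes every other index. A cylindric polyadic equality algebra in ${}_m\mathsf{CPEA}_\alpha$ is an algebra $\langle A,+,\cdot,-,0,1,c_i,s_\tau,d_{ij}\rangle_{i,j\in\alpha,\ \tau\in{}_mT_\alpha}$ such that $\langle A,+,\cdot,-,0,1\rangle$ is a Boolean algebra and, for all $x,y\in A$, $i,j\in\alpha$ and $\sigma,\tau\in{}_mT_\alpha$: 1. $c_i0=0$, $\;x\le c_ix$, $\;c_i(x\cdot c_iy)=c_ix\cdot c_iy$; 2. $s_{\mathrm{Id}}x=x$, $\;s_{\sigma\circ\tau}x=s_\sigma s_\tau x$, $\;s_\sigma(x+y)=s_\sigma x+s_\sigma y$, $\;s_\sigma(-x)=-s_\sigma x$; 3. $s_\sigma c_ix=s_\tau c_ix$ if $\sigma$ and $\tau$ agree on $\alpha\smallsetminus\{i\}$;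 4. $c_is_\sigma x\le s_\sigma c_jx$ if $\sigma^{-1}\{i\}=\{j\}$, and $c_is_\sigma x\le s_\sigma x$ if $\sigma^{-1}\{i\}=\emptyset$; 5. $d_{ii}=1$, $\;x\cdot d_{ij}\le s_{[i/j]}x$, $\;s_\tau d_{ij}=d_{\tau i\,\tau j}$. **Theorem (interpolation).** Let $\beta$ be a set (in particular, any cardinal) and let $\mathfrak A=\mathfrak{Fr}_\beta\,{}_m\mathsf{CPEA}_\alpha$ be the free ${}_m\mathsf{CPEA}_\alpha$-algebra whose free generators are (identified with) the elements of $\beta$. For $X\subseteq\beta$ let $\mathfrak{Sg}^{\mathfrak A}X$ be the subalgebra of $\mathfrak A$ generated by $X$. Let $X_1,X_2\subseteq\beta$, $a\in\mathfrak{Sg}^{\mathfrak A}X_1$ and $c\in\mathfrak{Sg}^{\mathfrak A}X_2$ be such that $a\le c$. Then there is $b\in\mathfrak{Sg}^{\mathfrak A}(X_1\cap X_2)$ with $a\le b\le c$. -/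

import Mathlib

universe u v w

/-- The set `ₘT_I` of the `m`-transformations of the index set `I`: the maps `τ : I → I` with
`τ i = i` except for at most `m` many `i ∈ I`. -/
def MTrans (m : Cardinal.{u}) (I : Type u) : Type u :=
  {τ : I → I // Cardinal.mk {i : I | τ i ≠ i} ≤ m}

open Classical in
/-- The elementary replacement `[i/j]`, which sends `i` to `j` and fixes all other indices. -/
noncomputable def replacement {I : Type u} (i j : I) : I → I :=
  Function.update id i j

/-- Cylindric polyadic equality algebras `ₘCPEA_I`, with dimension set `I`, whose substitutions
`s τ` are indexed by the `m`-transformations `τ`. Cylindrifications are not assumed to commute, and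
they commute with substitutions only in the weak form `cyl_subst`, `cyl_subst_empty`. -/
structure MCPEA (m : Cardinal.{u}) (I : Type u) where
  carrier : Type v
  [boolean : BooleanAlgebra carrier]
  /-- cylindrifications -/
  c : I → carrier → carrier
  /-- substitutions -/
  s : MTrans m I → carrier → carrier
  /-- diagonals -/
  d : I → I → carrier
  cyl_bot : ∀ i, c i ⊥ = ⊥
  le_cyl : ∀ i x, x ≤ c i x
  cyl_inf_cyl : ∀ i x y, c i (x ⊓ c i y) = c i x ⊓ c i y
  subst_id : ∀ (σ : MTrans m I) x, σ.1 = id → s σ x = x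
  subst_comp : ∀ (σ τ ρ : MTrans m I) x, ρ.1 = σ.1 ∘ τ.1 → s ρ x = s σ (s τ x)
  subst_sup : ∀ σ x y, s σ (x ⊔ y) = s σ x ⊔ s σ y
  subst_compl : ∀ σ x, s σ xᶜ = (s σ x)ᶜ
  /-- if `σ` and `τ` agree off `i` then `s_σ c_i x = s_τ c_i x` -/
  subst_cyl : ∀ (σ τ : MTrans m I) i x, (∀ k, k ≠ i → σ.1 k = τ.1 k) → s σ (c i x) = s τ (c i x)
  /-- `c_i s_σ x ≤ s_σ c_j x` if `σ⁻¹{i} = {j}` -/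
  cyl_subst : ∀ (σ : MTrans m I) i j x, σ.1 ⁻¹' {i} = {j} → c i (s σ x) ≤ s σ (c j x)
  /-- `c_i s_σ x ≤ s_σ x` if `σ⁻¹{i} = ∅` -/
  cyl_subst_empty : ∀ (σ : MTrans m I) i x, σ.1 ⁻¹' {i} = ∅ → c i (s σ x) ≤ s σ x
  diag_self : ∀ i, d i i = ⊤
  inf_diag_le : ∀ (ρ : MTrans m I) i j x, ρ.1 = replacement i j → x ⊓ d i j ≤ s ρ x
  subst_diag : ∀ (τ : MTrans m I) i j, s τ (d i j) = d (τ.1 i) (τ.1 j)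

namespace MCPEA

attribute [instance] MCPEA.boolean

variable {m : Cardinal.{u}} {I : Type u}

/-- `Sg^A X`, the (universe of the) subalgebra of `A` generated by `X`: the least subset of `A`
that contains `X` and is closed under all the operations. -/
inductive Sg (A : MCPEA.{u, v} m I) (X : Set A.carrier) : A.carrier → Prop
  | basic (x : A.carrier) : x ∈ X → Sg A X x
  | bot : Sg A X ⊥
  | top : Sg A X ⊤
  | sup (x y : A.carrier) : Sg A X x → Sg A X y → Sg A X (x ⊔ y)
  | inf (x y : A.carrier) : Sg A X x → Sg A X y → Sg A X (x ⊓ y)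
  | compl (x : A.carrier) : Sg A X x → Sg A X xᶜ
  | cyl (i : I) (x : A.carrier) : Sg A X x → Sg A X (A.c i x)
  | subst (τ : MTrans m I) (x : A.carrier) : Sg A X x → Sg A X (A.s τ x)
  | diag (i j : I) : Sg A X (A.d i j)

/-- The terms of the language of `ₘCPEA_I` in variables from `β`. -/
inductive PTerm (m : Cardinal.{u}) (I : Type u) (β : Type w) : Type (max u w)
  | var : β → PTerm m I β
  | bot : PTerm m I β
  | top : PTerm m I β
  | sup : PTerm m I β → PTerm m I β → PTerm m I β
  | inf : PTerm m I β → PTerm m I β → PTerm m I β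
  | compl : PTerm m I β → PTerm m I β
  | cyl : I → PTerm m I β → PTerm m I β
  | subst : MTrans m I → PTerm m I β → PTerm m I β
  | diag : I → I → PTerm m I β

/-- The value of a term in the algebra `A` under the assignment `v`. -/
def PTerm.eval {β : Type w} (A : MCPEA.{u, v} m I) (v : β → A.carrier) : PTerm m I β → A.carrier
  | .var b => v b
  | .bot => ⊥
  | .top => ⊤
  | .sup t t' => t.eval A v ⊔ t'.eval A v
  | .inf t t' => t.eval A v ⊓ t'.eval A v
  | .compl t => (t.eval A v)ᶜ
  | .cyl i t => A.c i (t.eval A v)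
  | .subst τ t => A.s τ (t.eval A v)
  | .diag i j => A.d i j

/-- Two terms are identified if the equation between them is valid in the class `ₘCPEA_I`. -/
def termSetoid (m : Cardinal.{u}) (I : Type u) (β : Type w) : Setoid (PTerm m I β) where
  r t t' := ∀ (A : MCPEA.{u, max u w} m I) (v : β → A.carrier), t.eval A v = t'.eval A v
  iseqv := ⟨fun _ _ _ => rfl, fun h A v => (h A v).symm, fun h h' A v => (h A v).trans (h' A v)⟩

/-- The universe of the free algebra: the term algebra modulo the intersection of the kernels of
all homomorphisms into members of the class. -/
def FrCarrier (m : Cardinal.{u}) (I : Type u) (β : Type w) : Type (max u w) :=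
  Quotient (termSetoid m I β)

section FreeBoolean

variable {β : Type w}

instance : Max (FrCarrier m I β) :=
  ⟨Quotient.map₂ PTerm.sup fun _ _ h _ _ h' A v => congrArg₂ (· ⊔ ·) (h A v) (h' A v)⟩

instance : Min (FrCarrier m I β) :=
  ⟨Quotient.map₂ PTerm.inf fun _ _ h _ _ h' A v => congrArg₂ (· ⊓ ·) (h A v) (h' A v)⟩

instance : Compl (FrCarrier m I β) :=
  ⟨Quotient.map PTerm.compl fun _ _ h A v => congrArg (·ᶜ) (h A v)⟩

instance : Bot (FrCarrier m I β) := ⟨Quotient.mk _ PTerm.bot⟩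

instance : Top (FrCarrier m I β) := ⟨Quotient.mk _ PTerm.top⟩

/-- The order is the Boolean one: `x ≤ y` iff `x ⊔ y = y`. -/
instance : BooleanAlgebra (FrCarrier m I β) :=
  letI L : Lattice (FrCarrier m I β) := Lattice.mk'
    (by rintro ⟨x⟩ ⟨y⟩; exact Quotient.sound fun A v => sup_comm _ _)
    (by rintro ⟨x⟩ ⟨y⟩ ⟨z⟩; exact Quotient.sound fun A v => sup_assoc _ _ _)
    (by rintro ⟨x⟩ ⟨y⟩; exact Quotient.sound fun A v => inf_comm _ _)
    (by rintro ⟨x⟩ ⟨y⟩ ⟨z⟩; exact Quotient.sound fun A v => inf_assoc _ _ _)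
    (by rintro ⟨x⟩ ⟨y⟩; exact Quotient.sound fun A v => sup_inf_self)
    (by rintro ⟨x⟩ ⟨y⟩; exact Quotient.sound fun A v => inf_sup_self)
  letI D : DistribLattice (FrCarrier m I β) :=
    { L with
      le_sup_inf := by
        rintro ⟨x⟩ ⟨y⟩ ⟨z⟩
        exact le_of_eq (Quotient.sound fun A v => (sup_inf_left _ _ _).symm) }
  { D with
    compl := fun x => xᶜ
    top := ⊤
    bot := ⊥
    le_top := by rintro ⟨x⟩; exact sup_eq_right.1 (Quotient.sound fun A v => sup_top_eq _)
    bot_le := by rintro ⟨x⟩; exact sup_eq_right.1 (Quotient.sound fun A v => bot_sup_eq _)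
    inf_compl_le_bot := by rintro ⟨x⟩; exact le_of_eq (Quotient.sound fun A v => inf_compl_self _)
    top_le_sup_compl := by
      rintro ⟨x⟩; exact le_of_eq (Quotient.sound fun A v => (sup_compl_eq_top).symm) }

end FreeBoolean

/-- The free algebra `Fr_β ₘCPEA_I`. -/
def Fr (m : Cardinal.{u}) (I : Type u) (β : Type w) : MCPEA.{u, max u w} m I where
  carrier := FrCarrier m I β
  c i := Quotient.map (PTerm.cyl i) fun _ _ h A v => congrArg (A.c i) (h A v)
  s τ := Quotient.map (PTerm.subst τ) fun _ _ h A v => congrArg (A.s τ) (h A v)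
  d i j := Quotient.mk _ (PTerm.diag i j)
  cyl_bot i := Quotient.sound fun A v => A.cyl_bot i
  le_cyl i := by
    rintro ⟨x⟩
    exact sup_eq_right.1 (Quotient.sound fun A v => sup_eq_right.2 (A.le_cyl i _))
  cyl_inf_cyl i := by
    rintro ⟨x⟩ ⟨y⟩
    exact Quotient.sound fun A v => A.cyl_inf_cyl i _ _
  subst_id := by
    rintro σ ⟨x⟩ h
    exact Quotient.sound fun A v => A.subst_id σ _ h
  subst_comp := by
    rintro σ τ ρ ⟨x⟩ h
    exact Quotient.sound fun A v => A.subst_comp σ τ ρ _ h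
  subst_sup := by
    rintro σ ⟨x⟩ ⟨y⟩
    exact Quotient.sound fun A v => A.subst_sup σ _ _
  subst_compl := by
    rintro σ ⟨x⟩
    exact Quotient.sound fun A v => A.subst_compl σ _
  subst_cyl := by
    rintro σ τ i ⟨x⟩ h
    exact Quotient.sound fun A v => A.subst_cyl σ τ i _ h
  cyl_subst := by
    rintro σ i j ⟨x⟩ h
    exact sup_eq_right.1 (Quotient.sound fun A v => sup_eq_right.2 (A.cyl_subst σ i j _ h))
  cyl_subst_empty := by
    rintro σ i ⟨x⟩ h
    exact sup_eq_right.1 (Quotient.sound fun A v => sup_eq_right.2 (A.cyl_subst_empty σ i _ h))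
  diag_self i := Quotient.sound fun A v => A.diag_self i
  inf_diag_le := by
    rintro ρ i j ⟨x⟩ h
    exact sup_eq_right.1 (Quotient.sound fun A v => sup_eq_right.2 (A.inf_diag_le ρ i j _ h))
  subst_diag τ i j := Quotient.sound fun A v => A.subst_diag τ i j

/-- The free generators of `Fr_β ₘCPEA_I`. -/
def gen (m : Cardinal.{u}) (I : Type u) {β : Type w} (b : β) : (Fr m I β).carrier :=
  Quotient.mk (termSetoid m I β) (PTerm.var b)

end MCPEA

/-! Suppose that no interpolant exists. Two ultrafilters F and G of the free algebra then agree on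
`Sg X`, where X is the set of common generators, with a in F and c not in G (`exists_agreeingPair`).

The pairs of ultrafilters agreeing on `Sg X` form a frame, with coordinatewise relations
(`zigzagFrame`). The frame conditions dual to the axioms are universal Horn, so they pass to
products and to subsets closed under the dual maps. Commutation of cylindrifications would require
an existential condition, which need not pass to such subsets.

Each projection of this frame is a bounded morphism (`exists_cylRel_agreeing`). Hence, under one
valuation, a holds at (F, G) since a is in F, and c fails there since c is not in G
(`exists_term_eval_eq`). But the complex algebra is in the class, so it satisfies a ≤ c: a
contradiction. -/

namespace MCPEA

/-! ### Elementary Boolean and closure laws -/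

section Cylindrification

variable {m : Cardinal.{u}} {I : Type u} (A : MCPEA.{u, v} m I)

theorem cyl_cyl (i : I) (x : A.carrier) : A.c i (A.c i x) = A.c i x := by
  have h := A.cyl_inf_cyl i ⊤ x
  rwa [top_inf_eq, top_le_iff.1 (A.le_cyl i ⊤), top_inf_eq] at h

theorem cyl_le_cyl_of_le_cyl {i : I} {x y : A.carrier} (h : x ≤ A.c i y) :
    A.c i x ≤ A.c i y := by
  have h' := A.cyl_inf_cyl i x y
  rw [inf_eq_left.2 h] at h'
  exact inf_eq_left.1 h'.symm

theorem subst_inf (σ : MTrans m I) (x y : A.carrier) :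
    A.s σ (x ⊓ y) = A.s σ x ⊓ A.s σ y := by
  have h := A.subst_sup σ xᶜ yᶜ
  rw [← compl_inf, A.subst_compl, A.subst_compl, A.subst_compl, ← compl_inf] at h
  exact compl_injective h

end Cylindrification

/-! ### Frames and their complex algebras -/

/-- Relational frames for `ₘCPEA_I`: the duals of the axioms are universal Horn conditions. -/
structure Frame (m : Cardinal.{u}) (I : Type u) where
  /-- the points of the frame -/
  World : Type v
  /-- the accessibility relations of the cylindrifications -/
  R : I → World → World → Prop
  /-- the maps dual to the substitutions -/
  f : MTrans m I → World → World
  /-- the diagonal sets -/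
  D : I → I → World → Prop
  refl : ∀ i w, R i w w
  symm : ∀ i w w', R i w w' → R i w' w
  trans : ∀ i w w' w'', R i w w' → R i w' w'' → R i w w''
  f_id : ∀ (σ : MTrans m I) w, σ.1 = id → f σ w = w
  -- Duality is contravariant, so the order of composition is reversed.
  f_comp : ∀ (σ τ ρ : MTrans m I) w, ρ.1 = σ.1 ∘ τ.1 → f ρ w = f τ (f σ w)
  f_agree : ∀ (σ τ : MTrans m I) i w, (∀ k, k ≠ i → σ.1 k = τ.1 k) → R i (f σ w) (f τ w)
  f_single : ∀ (σ : MTrans m I) i j w w', σ.1 ⁻¹' {i} = {j} → R i w w' → R j (f σ w) (f σ w')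
  f_empty : ∀ (σ : MTrans m I) i w w', σ.1 ⁻¹' {i} = ∅ → R i w w' → f σ w = f σ w'
  D_self : ∀ i w, D i i w
  f_replacement : ∀ (ρ : MTrans m I) i j w, ρ.1 = replacement i j → D i j w → f ρ w = w
  D_subst : ∀ (τ : MTrans m I) i j w, D i j (f τ w) ↔ D (τ.1 i) (τ.1 j) w

/-- The complex algebra of a frame. -/
def Frame.complexAlgebra {m : Cardinal.{u}} {I : Type u} (K : Frame.{u, v} m I) :
    MCPEA.{u, v} m I where
  carrier := Set K.World
  c i S := {w | ∃ w', K.R i w w' ∧ w' ∈ S}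
  s σ S := {w | K.f σ w ∈ S}
  d i j := {w | K.D i j w}
  cyl_bot i := by
    ext w
    exact ⟨fun ⟨_, _, h⟩ => h, fun h => h.elim⟩
  le_cyl i S w hw := ⟨w, K.refl i w, hw⟩
  cyl_inf_cyl i S T := by
    ext w
    constructor
    · rintro ⟨w', hR, hS, w'', hR', hT⟩
      exact ⟨⟨w', hR, hS⟩, ⟨w'', K.trans _ _ _ _ hR hR', hT⟩⟩
    · rintro ⟨⟨w', hR, hS⟩, ⟨w'', hR', hT⟩⟩
      exact ⟨w', hR, hS, w'', K.trans _ _ _ _ (K.symm _ _ _ hR) hR', hT⟩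
  subst_id σ S h := by
    ext w
    exact iff_of_eq (congrArg (· ∈ S) (K.f_id σ w h))
  subst_comp σ τ ρ S h := by
    ext w
    exact iff_of_eq (congrArg (· ∈ S) (K.f_comp σ τ ρ w h))
  subst_sup σ S T := rfl
  subst_compl σ S := rfl
  subst_cyl σ τ i S h := by
    have key : ∀ σ τ : MTrans m I, (∀ k, k ≠ i → σ.1 k = τ.1 k) → ∀ w,
        (∃ w', K.R i (K.f σ w) w' ∧ w' ∈ S) → ∃ w', K.R i (K.f τ w) w' ∧ w' ∈ S := by
      rintro σ τ h w ⟨w', hR, hS⟩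
      exact ⟨w', K.trans _ _ _ _ (K.symm _ _ _ (K.f_agree σ τ i w h)) hR, hS⟩
    ext w
    exact ⟨key σ τ h w, key τ σ (fun k hk => (h k hk).symm) w⟩
  cyl_subst σ i j S h := by
    rintro w ⟨w', hR, hS⟩
    exact ⟨K.f σ w', K.f_single σ i j w w' h hR, hS⟩
  cyl_subst_empty σ i S h := by
    rintro w ⟨w', hR, hS⟩
    change K.f σ w ∈ S
    rw [K.f_empty σ i w w' h hR]
    exact hS
  diag_self i := Set.eq_univ_of_forall (K.D_self i)
  inf_diag_le ρ i j S h := by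
    rintro w ⟨hS, hD⟩
    change K.f ρ w ∈ S
    rw [K.f_replacement ρ i j w h hD]
    exact hS
  subst_diag τ i j := by
    ext w
    exact K.D_subst τ i j w

/-! ### Ultrafilters -/

/-- Ultrafilters of a Boolean algebra. -/
@[ext]
structure BoolUltrafilter (B : Type v) [BooleanAlgebra B] where
  /-- the elements of the ultrafilter -/
  sets : Set B
  inf_mem_iff : ∀ x y, x ⊓ y ∈ sets ↔ x ∈ sets ∧ y ∈ sets
  compl_mem_iff : ∀ x, xᶜ ∈ sets ↔ x ∉ sets

namespace BoolUltrafilter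

variable {B : Type v} [BooleanAlgebra B] (F : BoolUltrafilter B)

theorem mem_of_le {x y : B} (h : x ≤ y) (hx : x ∈ F.sets) : y ∈ F.sets := by
  rw [← inf_eq_left.2 h] at hx
  exact ((F.inf_mem_iff _ _).1 hx).2

theorem bot_notMem : ⊥ ∉ F.sets := fun h =>
  (F.compl_mem_iff ⊥).1 (F.mem_of_le bot_le h) h

theorem top_mem : ⊤ ∈ F.sets := by
  rw [← compl_bot, F.compl_mem_iff]
  exact F.bot_notMem

theorem sup_mem_iff (x y : B) : x ⊔ y ∈ F.sets ↔ x ∈ F.sets ∨ y ∈ F.sets := by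
  rw [← not_iff_not, ← F.compl_mem_iff, compl_sup, F.inf_mem_iff, F.compl_mem_iff,
    F.compl_mem_iff, not_or]

/-- Two filter bases whose members never meet in `⊥` are contained in a common ultrafilter. -/
theorem exists_of_inf_ne_bot (S T : Set B) (hS : S.Nonempty) (hT : T.Nonempty)
    (hS' : ∀ x ∈ S, ∀ y ∈ S, x ⊓ y ∈ S) (hT' : ∀ x ∈ T, ∀ y ∈ T, x ⊓ y ∈ T)
    (h : ∀ x ∈ S, ∀ y ∈ T, x ⊓ y ≠ ⊥) :
    ∃ F : BoolUltrafilter B, S ⊆ F.sets ∧ T ⊆ F.sets := by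
  obtain ⟨s₀, hs₀⟩ := hS
  obtain ⟨t₀, ht₀⟩ := hT
  have hP : Order.IsPFilter {z : B | ∃ x ∈ S, ∃ y ∈ T, x ⊓ y ≤ z} := by
    refine Order.IsPFilter.of_def ⟨s₀ ⊓ t₀, s₀, hs₀, t₀, ht₀, le_rfl⟩ ?_ ?_
    · rintro z ⟨x, hx, y, hy, hz⟩ z' ⟨x', hx', y', hy', hz'⟩
      refine ⟨z ⊓ z', ⟨x ⊓ x', hS' _ hx _ hx', y ⊓ y', hT' _ hy _ hy', ?_⟩,
        inf_le_left, inf_le_right⟩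
      rw [inf_inf_inf_comm]
      exact inf_le_inf hz hz'
    · rintro z z' hzz' ⟨x, hx, y, hy, hz⟩
      exact ⟨x, hx, y, hy, hz.trans hzz'⟩
  obtain ⟨J, hJ, -, hd⟩ := DistribLattice.prime_ideal_of_disjoint_filter_ideal
    (F := hP.toPFilter) (I := Order.Ideal.principal ⊥) (by
      rw [Set.disjoint_left]
      rintro z ⟨x, hx, y, hy, hz⟩ hz'
      exact h x hx y hy (le_bot_iff.1 (hz.trans (Order.Ideal.mem_principal.1 hz'))))
  rw [Set.disjoint_left] at hd
  refine ⟨⟨{z | z ∉ J}, fun x y => ?_, fun x => ?_⟩, fun x hx => ?_, fun y hy => ?_⟩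
  · change ¬ _ ↔ ¬ _ ∧ ¬ _
    rw [← not_or, not_iff_not]
    exact ⟨hJ.mem_or_mem, fun h => h.elim (J.lower inf_le_left) (J.lower inf_le_right)⟩
  · change ¬ _ ↔ ¬ ¬ _
    rw [not_not]
    exact ⟨fun hx => hJ.mem_or_compl_mem.resolve_right hx, fun hx hx' =>
      hJ.toIsProper.ne_univ <| Set.eq_univ_of_forall fun z =>
        J.lower (le_top.trans_eq sup_compl_eq_top.symm) (J.sup_mem hx hx')⟩
  · exact hd ⟨x, hx, t₀, ht₀, inf_le_left⟩
  · exact hd ⟨s₀, hs₀, y, hy, inf_le_right⟩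

end BoolUltrafilter

/-! ### Canonical relations and the zigzag product -/

section Canonical

variable {m : Cardinal.{u}} {I : Type u} (A : MCPEA.{u, v} m I)

/-- The canonical accessibility relation of `c_i` on ultrafilters. -/
def CylRel (i : I) (F G : BoolUltrafilter A.carrier) : Prop :=
  ∀ x, A.c i x ∈ F.sets ↔ A.c i x ∈ G.sets

/-- The canonical map on ultrafilters dual to a substitution. -/
def substPreimage (σ : MTrans m I) (F : BoolUltrafilter A.carrier) :
    BoolUltrafilter A.carrier where
  sets := {x | A.s σ x ∈ F.sets}
  inf_mem_iff x y := by
    change A.s σ (x ⊓ y) ∈ F.sets ↔ _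
    rw [A.subst_inf]
    exact F.inf_mem_iff _ _
  compl_mem_iff x := by
    change A.s σ xᶜ ∈ F.sets ↔ _
    rw [A.subst_compl]
    exact F.compl_mem_iff _

theorem mem_substPreimage (σ : MTrans m I) (F : BoolUltrafilter A.carrier) (x : A.carrier) :
    x ∈ (substPreimage A σ F).sets ↔ A.s σ x ∈ F.sets := Iff.rfl

variable {A}

theorem BoolUltrafilter.eq_of_subset {B : Type v} [BooleanAlgebra B] {F G : BoolUltrafilter B}
    (h : F.sets ⊆ G.sets) : F = G := by
  ext x
  refine ⟨fun hx => h hx, fun hx => ?_⟩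
  by_contra hx'
  exact (G.compl_mem_iff x).1 (h ((F.compl_mem_iff x).2 hx')) hx

/-- The complement of a `c_i`-closed element has a cylindrification disjoint from that element, so a
one-sided condition forces equivalence. Thus the inequality `cyl_subst` suffices for `f_single`. -/
theorem CylRel.of_forall_mem {i : I} {F G : BoolUltrafilter A.carrier}
    (h : ∀ x ∈ F.sets, A.c i x ∈ G.sets) : CylRel A i F G := by
  have h1 : ∀ x, A.c i x ∈ F.sets → A.c i x ∈ G.sets := fun x hx => by
    simpa only [A.cyl_cyl] using h _ hx
  refine fun x => ⟨h1 x, fun hx => ?_⟩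
  by_contra hx'
  have h2 := h _ ((F.compl_mem_iff _).2 hx')
  have h3 : A.c i (A.c i x)ᶜ ⊓ A.c i x = ⊥ := by
    rw [← A.cyl_inf_cyl, compl_inf_eq_bot, A.cyl_bot]
  exact G.bot_notMem (h3 ▸ (G.inf_mem_iff _ _).2 ⟨h2, hx⟩)

theorem CylRel.cyl_mem {i : I} {F G : BoolUltrafilter A.carrier} (h : CylRel A i F G)
    {x : A.carrier} (hx : x ∈ G.sets) : A.c i x ∈ F.sets :=
  (h x).2 (G.mem_of_le (A.le_cyl i x) hx)

/-- A filter base `S` all of whose cylindrifications belong to `F` is contained in an ultrafilter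
accessible from `F`. -/
theorem exists_cylRel (i : I) (F : BoolUltrafilter A.carrier) (S : Set A.carrier)
    (hS : S.Nonempty) (hS' : ∀ x ∈ S, ∀ y ∈ S, x ⊓ y ∈ S) (h : ∀ x ∈ S, A.c i x ∈ F.sets) :
    ∃ G : BoolUltrafilter A.carrier, CylRel A i F G ∧ S ⊆ G.sets := by
  obtain ⟨G, hSG, hG⟩ := BoolUltrafilter.exists_of_inf_ne_bot S
    -- Closed elements are stable under complement, so containing those of F already makes G
    -- accessible from F.
    {y | A.c i y = y ∧ y ∈ F.sets} hS
    ⟨⊤, top_le_iff.1 (A.le_cyl i ⊤), F.top_mem⟩ hS'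
    (by
      rintro x ⟨hx, hxF⟩ y ⟨hy, hyF⟩
      refine ⟨?_, (F.inf_mem_iff _ _).2 ⟨hxF, hyF⟩⟩
      rw [← hy, A.cyl_inf_cyl, hx])
    (by
      rintro x hx y ⟨hy, hyF⟩ h0
      have h1 := A.cyl_inf_cyl i x y
      rw [hy, h0, A.cyl_bot] at h1
      exact F.bot_notMem (h1 ▸ (F.inf_mem_iff _ _).2 ⟨h x hx, hyF⟩))
  refine ⟨G, fun x => ⟨fun hx => hG ⟨A.cyl_cyl i x, hx⟩, fun hx => ?_⟩, hSG⟩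
  by_contra hx'
  have h2 : A.c i (A.c i x)ᶜ = (A.c i x)ᶜ := by
    refine le_antisymm ?_ (A.le_cyl _ _)
    rw [le_compl_iff_disjoint_right, disjoint_iff, ← A.cyl_inf_cyl, compl_inf_eq_bot, A.cyl_bot]
  exact (G.compl_mem_iff _).1 (hG ⟨h2, (F.compl_mem_iff _).2 hx'⟩) hx

variable (A)

/-- Pairs of ultrafilters that agree on the subalgebra generated by `X`. -/
def AgreeingPair (X : Set A.carrier) : Type v :=
  {p : BoolUltrafilter A.carrier × BoolUltrafilter A.carrier //
    ∀ x, Sg A X x → (x ∈ p.1.sets ↔ x ∈ p.2.sets)}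

/-- The zigzag product of the canonical frame with itself over the subalgebra generated by `X`. -/
def zigzagFrame (X : Set A.carrier) : Frame.{u, v} m I where
  World := AgreeingPair A X
  R i p q := CylRel A i p.1.1 q.1.1 ∧ CylRel A i p.1.2 q.1.2
  f σ p := ⟨(substPreimage A σ p.1.1, substPreimage A σ p.1.2),
    fun x hx => p.2 _ (Sg.subst σ x hx)⟩
  -- Either coordinate may be used: diagonals lie in every `Sg A X`.
  D i j p := A.d i j ∈ p.1.1.sets
  refl i p := ⟨fun _ => Iff.rfl, fun _ => Iff.rfl⟩
  symm i p q h := ⟨fun x => (h.1 x).symm, fun x => (h.2 x).symm⟩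
  trans i p q r h h' := ⟨fun x => (h.1 x).trans (h'.1 x), fun x => (h.2 x).trans (h'.2 x)⟩
  f_id σ p h := by
    have key (F : BoolUltrafilter A.carrier) : substPreimage A σ F = F := by
      ext x
      rw [mem_substPreimage, A.subst_id σ x h]
    exact Subtype.ext (Prod.ext (key _) (key _))
  f_comp σ τ ρ p h := by
    have key (F : BoolUltrafilter A.carrier) :
        substPreimage A ρ F = substPreimage A τ (substPreimage A σ F) := by
      ext x
      rw [mem_substPreimage, mem_substPreimage, mem_substPreimage, A.subst_comp σ τ ρ x h]
    exact Subtype.ext (Prod.ext (key _) (key _))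
  f_agree σ τ i p h := by
    have key (F : BoolUltrafilter A.carrier) :
        CylRel A i (substPreimage A σ F) (substPreimage A τ F) := by
      intro x
      rw [mem_substPreimage, mem_substPreimage, A.subst_cyl σ τ i x h]
    exact ⟨key _, key _⟩
  f_single σ i j p q h hR := by
    have key (F G : BoolUltrafilter A.carrier) (hFG : CylRel A i F G) :
        CylRel A j (substPreimage A σ F) (substPreimage A σ G) :=
      CylRel.of_forall_mem fun x hx => G.mem_of_le (A.cyl_subst σ i j x h)
        ((hFG _).1 (F.mem_of_le (A.le_cyl i _) hx))
    exact ⟨key _ _ hR.1, key _ _ hR.2⟩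
  f_empty σ i p q h hR := by
    have key (F G : BoolUltrafilter A.carrier) (hFG : CylRel A i F G) :
        substPreimage A σ F = substPreimage A σ G :=
      BoolUltrafilter.eq_of_subset fun x hx => G.mem_of_le (A.cyl_subst_empty σ i x h)
        ((hFG _).1 (F.mem_of_le (A.le_cyl i _) hx))
    exact Subtype.ext (Prod.ext (key _ _ hR.1) (key _ _ hR.2))
  D_self i p := by
    rw [A.diag_self]
    exact p.1.1.top_mem
  f_replacement ρ i j p h hD := by
    have key (F : BoolUltrafilter A.carrier) (hF : A.d i j ∈ F.sets) :
        substPreimage A ρ F = F :=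
      (BoolUltrafilter.eq_of_subset (G := substPreimage A ρ F) fun x hx =>
        F.mem_of_le (A.inf_diag_le ρ i j x h) ((F.inf_mem_iff _ _).2 ⟨hx, hF⟩)).symm
    exact Subtype.ext (Prod.ext (key _ hD) (key _ ((p.2 _ (Sg.diag i j)).1 hD)))
  D_subst τ i j p := by
    rw [mem_substPreimage, A.subst_diag]

variable {A}

/-- One half of the zigzag property: a `c_i`-step in one coordinate lifts to agreeing pairs. -/
theorem exists_cylRel_agreeing {X : Set A.carrier} {i : I} {F G F' : BoolUltrafilter A.carrier}
    (hFG : ∀ x, Sg A X x → (x ∈ F.sets ↔ x ∈ G.sets)) (hF : CylRel A i F F') :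
    ∃ G' : BoolUltrafilter A.carrier, CylRel A i G G' ∧
      ∀ x, Sg A X x → (x ∈ F'.sets ↔ x ∈ G'.sets) := by
  -- For x in both `Sg A X` and F', the element `c_i x` is in F and in `Sg A X`, hence in G.
  obtain ⟨G', hG', hS⟩ := exists_cylRel i G {x | Sg A X x ∧ x ∈ F'.sets}
    ⟨⊤, Sg.top, F'.top_mem⟩
    (fun x hx y hy => ⟨Sg.inf x y hx.1 hy.1, (F'.inf_mem_iff _ _).2 ⟨hx.2, hy.2⟩⟩)
    (fun x hx => (hFG _ (Sg.cyl i x hx.1)).1 (hF.cyl_mem hx.2))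
  refine ⟨G', hG', fun x hx => ⟨fun h => hS ⟨hx, h⟩, fun h => ?_⟩⟩
  by_contra h'
  exact (G'.compl_mem_iff x).1 (hS ⟨Sg.compl x hx, (F'.compl_mem_iff x).2 h'⟩) h

/-- Without an interpolant, `a` and `cᶜ` can be realised in an agreeing pair. -/
theorem exists_agreeingPair {X : Set A.carrier} {a c : A.carrier}
    (h : ∀ b, Sg A X b → a ≤ b → ¬ b ≤ c) :
    ∃ p : AgreeingPair A X, a ∈ p.1.1.sets ∧ c ∉ p.1.2.sets := by
  -- A bound b of a in `Sg A X` disjoint from `cᶜ` would be an interpolant.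
  obtain ⟨G, hG, hGc⟩ := BoolUltrafilter.exists_of_inf_ne_bot {b | Sg A X b ∧ a ≤ b} {cᶜ}
    ⟨⊤, Sg.top, le_top⟩ ⟨_, rfl⟩
    (fun x hx y hy => ⟨Sg.inf x y hx.1 hy.1, le_inf hx.2 hy.2⟩)
    (by rintro x rfl y rfl; exact inf_idem _)
    (by
      rintro b ⟨hb, hab⟩ y rfl h0
      exact h b hb hab (by rwa [← disjoint_compl_right_iff, disjoint_iff]))
  -- If b in G and `Sg A X` were disjoint from a, then `bᶜ` would be a bound of a, hence in G.
  obtain ⟨F, hF, hFa⟩ := BoolUltrafilter.exists_of_inf_ne_bot {b | Sg A X b ∧ b ∈ G.sets} {a}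
    ⟨⊤, Sg.top, G.top_mem⟩ ⟨_, rfl⟩
    (fun x hx y hy => ⟨Sg.inf x y hx.1 hy.1, (G.inf_mem_iff _ _).2 ⟨hx.2, hy.2⟩⟩)
    (by rintro x rfl y rfl; exact inf_idem _)
    (by
      rintro b ⟨hb, hbG⟩ y rfl h0
      refine (G.compl_mem_iff b).1 (hG ⟨Sg.compl b hb, ?_⟩) hbG
      rwa [le_compl_iff_disjoint_left, disjoint_iff])
  refine ⟨⟨(F, G), fun x hx => ⟨fun hxF => ?_, fun hxG => hF ⟨hx, hxG⟩⟩⟩, hFa rfl,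
    (G.compl_mem_iff c).1 (hGc rfl)⟩
  by_contra hxG
  exact (F.compl_mem_iff x).1 (hF ⟨Sg.compl x hx, (G.compl_mem_iff x).2 hxG⟩) hxF

end Canonical

/-! ### The truth lemma and interpolation -/

section Truth

variable {m : Cardinal.{u}} {I : Type u} {β : Type w}

/-- Truth lemma: a coordinate map from a frame to ultrafilters of the free algebra that
respects generators and is a bounded morphism computes the values of generated elements. -/
theorem exists_term_eval_eq (K : Frame.{u, max u w} m I) (v : β → Set K.World)
    (π : K.World → BoolUltrafilter (Fr m I β).carrier) (Y : Set β)
    (hv : ∀ y ∈ Y, ∀ p, p ∈ v y ↔ gen m I y ∈ (π p).sets)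
    (hR : ∀ i p q, K.R i p q → CylRel (Fr m I β) i (π p) (π q))
    (hR' : ∀ i p F, CylRel (Fr m I β) i (π p) F → ∃ q, K.R i p q ∧ π q = F)
    (hf : ∀ σ p, π (K.f σ p) = substPreimage (Fr m I β) σ (π p))
    (hD : ∀ i j p, K.D i j p ↔ (Fr m I β).d i j ∈ (π p).sets)
    {x : (Fr m I β).carrier} (hx : Sg (Fr m I β) (gen m I '' Y) x) :
    ∃ t : PTerm m I β, Quotient.mk (termSetoid m I β) t = x ∧
      t.eval K.complexAlgebra v = {p | x ∈ (π p).sets} := by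
  induction hx with
  | basic x hx =>
    obtain ⟨y, hy, rfl⟩ := hx
    exact ⟨.var y, rfl, Set.ext (hv y hy)⟩
  | bot => exact ⟨.bot, rfl, Set.ext fun p => ⟨False.elim, (π p).bot_notMem⟩⟩
  | top => exact ⟨.top, rfl, Set.ext fun p => ⟨fun _ => (π p).top_mem, fun _ => trivial⟩⟩
  | sup x y _ _ hx hy =>
    obtain ⟨t, rfl, ht⟩ := hx
    obtain ⟨t', rfl, ht'⟩ := hy
    refine ⟨.sup t t', rfl, ?_⟩
    simp only [PTerm.eval]
    rw [ht, ht']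
    exact Set.ext fun p => ((π p).sup_mem_iff _ _).symm
  | inf x y _ _ hx hy =>
    obtain ⟨t, rfl, ht⟩ := hx
    obtain ⟨t', rfl, ht'⟩ := hy
    refine ⟨.inf t t', rfl, ?_⟩
    simp only [PTerm.eval]
    rw [ht, ht']
    exact Set.ext fun p => ((π p).inf_mem_iff _ _).symm
  | compl x _ hx =>
    obtain ⟨t, rfl, ht⟩ := hx
    refine ⟨.compl t, rfl, ?_⟩
    simp only [PTerm.eval]
    rw [ht]
    exact Set.ext fun p => ((π p).compl_mem_iff _).symm
  | cyl i x _ hx =>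
    obtain ⟨t, rfl, ht⟩ := hx
    refine ⟨.cyl i t, rfl, ?_⟩
    simp only [PTerm.eval]
    rw [ht]
    refine Set.ext fun p => ⟨?_, fun hp => ?_⟩
    · rintro ⟨q, hq, hxq⟩
      exact (hR i p q hq).cyl_mem hxq
    -- The ultrafilter F witnesses `c_i` canonically; the back condition `hR'` lifts it to a point
    -- of K.
    · obtain ⟨F, hF, hxF⟩ := exists_cylRel (A := Fr m I β) i (π p) {Quotient.mk _ t} ⟨_, rfl⟩
        (by rintro x rfl y rfl; exact inf_idem _) (by rintro x rfl; exact hp)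
      obtain ⟨q, hq, rfl⟩ := hR' i p F hF
      exact ⟨q, hq, hxF rfl⟩
  | subst τ x _ hx =>
    obtain ⟨t, rfl, ht⟩ := hx
    refine ⟨.subst τ t, rfl, ?_⟩
    simp only [PTerm.eval]
    rw [ht]
    refine Set.ext fun p => ?_
    change _ ∈ (π (K.f τ p)).sets ↔ _
    rw [hf]
    rfl
  | diag i j => exact ⟨.diag i j, rfl, Set.ext (hD i j)⟩

/-- Craig interpolation for free `ₘCPEA_I`-algebras, for any cardinal `m` and any index set. -/
theorem interpolation (X₁ X₂ : Set β) (a c : (Fr m I β).carrier)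
    (ha : Sg (Fr m I β) (gen m I '' X₁) a) (hc : Sg (Fr m I β) (gen m I '' X₂) c) (hac : a ≤ c) :
    ∃ b : (Fr m I β).carrier, Sg (Fr m I β) (gen m I '' (X₁ ∩ X₂)) b ∧ a ≤ b ∧ b ≤ c := by
  by_contra! hno
  obtain ⟨p, hpa, hpc⟩ := exists_agreeingPair hno
  set X := gen m I '' (X₁ ∩ X₂) with hX
  let K : Frame.{u, max u w} m I := zigzagFrame (Fr m I β) X
  -- Generators in `X₁` are read in the first coordinate, those in `X₂` in the second; on common
  -- generators the two readings agree.
  let v : β → Set K.World := fun y =>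
    {q | (y ∈ X₁ ∧ gen m I y ∈ q.1.1.sets) ∨ (y ∈ X₂ ∧ gen m I y ∈ q.1.2.sets)}
  have hgen (y : β) (h1 : y ∈ X₁) (h2 : y ∈ X₂) (q : K.World) :
      gen m I y ∈ q.1.1.sets ↔ gen m I y ∈ q.1.2.sets :=
    q.2 _ (Sg.basic _ ⟨y, ⟨h1, h2⟩, rfl⟩)
  obtain ⟨t, rfl, ht⟩ := exists_term_eval_eq K v (fun q => q.1.1) X₁
    (fun y hy q => ⟨fun h => h.elim (·.2) fun h => (hgen y hy h.1 q).2 h.2,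
      fun h => Or.inl ⟨hy, h⟩⟩)
    (fun i q r h => h.1)
    (fun i q F hF => by
      obtain ⟨G, hG, hFG⟩ := exists_cylRel_agreeing q.2 hF
      exact ⟨⟨(F, G), hFG⟩, ⟨hF, hG⟩, rfl⟩)
    (fun σ q => rfl) (fun i j q => Iff.rfl) ha
  obtain ⟨t', rfl, ht'⟩ := exists_term_eval_eq K v (fun q => q.1.2) X₂
    (fun y hy q => ⟨fun h => h.elim (fun h => (hgen y h.1 hy q).1 h.2) (·.2),
      fun h => Or.inr ⟨hy, h⟩⟩)
    (fun i q r h => h.2)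
    (fun i q G hG => by
      obtain ⟨F, hF, hFG⟩ := exists_cylRel_agreeing (fun x hx => (q.2 x hx).symm) hG
      exact ⟨⟨(F, G), fun x hx => (hFG x hx).symm⟩, ⟨hF, hG⟩, rfl⟩)
    (fun σ q => rfl) (fun i j q => q.2 _ (Sg.diag i j)) hc
  -- An inequality in the free algebra is an equation valid throughout the class, in particular in
  -- the complex algebra of K.
  have hle : t.eval K.complexAlgebra v ⊔ t'.eval K.complexAlgebra v =
      t'.eval K.complexAlgebra v :=
    Quotient.exact (s := termSetoid m I β) (a := t.sup t') (b := t') (sup_eq_right.2 hac)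
      K.complexAlgebra v
  rw [sup_eq_right, ht, ht'] at hle
  exact hpc (hle hpa)

end Truth

end MCPEA

theorem mainTheorem2 (α m : Ordinal.{u}) (hm : Ordinal.omega0 ≤ m) (hmα : m < α)
    (β : Type w) (X₁ X₂ : Set β)
    (a c : (MCPEA.Fr m.card α.ToType β).carrier)
    (ha : MCPEA.Sg (MCPEA.Fr m.card α.ToType β) (MCPEA.gen m.card α.ToType '' X₁) a)
    (hc : MCPEA.Sg (MCPEA.Fr m.card α.ToType β) (MCPEA.gen m.card α.ToType '' X₂) c)
    (hac : a ≤ c) :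
    ∃ b : (MCPEA.Fr m.card α.ToType β).carrier,
      MCPEA.Sg (MCPEA.Fr m.card α.ToType β) (MCPEA.gen m.card α.ToType '' (X₁ ∩ X₂)) b ∧
        a ≤ b ∧ b ≤ c :=
  MCPEA.interpolation X₁ X₂ a c ha hc hac
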